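/- Let $n \ge 2$. For $X=(x_1,\dots,x_n)$ and $Y=(y_1,\dots,y_n)$ in $\mathbb{C}^n$ put $\varphi_n(X,Y)=\sum_{i=1}^n (x_i-y_i)^2$. A map $f:\mathbb{C}^n\to\mathbb{C}^n$ is said to preserve distance $d\in\mathbb{C}$ if for all $X,Y\in\mathbb{C}^n$, $\varphi_n(X,Y)=d^2$ implies $\varphi_n(f(X),f(Y))=d^2$. Let $\tau:\mathbb{C}\to\mathbb{C}$ denote complex conjugation, and for $d\in\mathbb{C}\setminus\{0\}$ let $\tau_d:\mathbb{C}\to\mathbb{C}$, $\tau_d(x)=\frac{d}{\tau(d)}\cdot\tau(x)$. **Theorem 5.** If $d\in\mathbb{C}\setminus\{0\}$ and a continuous map $f:\mathbb{C}^n\to\mathbb{C}^n$ preserves distance $d$, then $f$ has the form $f=I\circ(\rho,\dots,\rho)$ ($n$ copies of $\rho$, acting coordinatewise), where $\rho\in\{\mathrm{id}_{\mathbb{C}},\tau_d\}$ and $I:\mathbb{C}^n\to\mathbb{C}^n$ is a complex affine mapping whose linear part is orthogonal, that is, its matrix $A$ satisfies $A A^{\mathsf T}=\mathrm{Id}$ (transpose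 without conjugation). -/

import Mathlib

/-- The complex symmetric form `φ_n(X, Y) = ∑ i, (x_i - y_i) ^ 2` on `ℂⁿ` (no conjugation). -/
def phi {n : ℕ} (X Y : Fin n → ℂ) : ℂ :=
  ∑ i, (X i - Y i) ^ 2

/-- `f : ℂⁿ → ℂⁿ` preserves distance `d ∈ ℂ`: `φ_n(X, Y) = d ^ 2` implies
`φ_n(f X, f Y) = d ^ 2`. -/
def PreservesDistance {n : ℕ} (f : (Fin n → ℂ) → (Fin n → ℂ)) (d : ℂ) : Prop :=
  ∀ X Y : Fin n → ℂ, phi X Y = d ^ 2 → phi (f X) (f Y) = d ^ 2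

/-- The map `τ_d : ℂ → ℂ`, `x ↦ (d / τ d) * τ x`, where `τ` is complex conjugation. -/
noncomputable def tauD (d : ℂ) : ℂ → ℂ :=
  fun x => d / (starRingEnd ℂ) d * (starRingEnd ℂ) x

/-- The linear part of the (complex) affine map `I` is orthogonal: its matrix `A` in the standard
basis satisfies `A * Aᵀ = 1`. (`Matrix.orthogonalGroup` uses the transpose, not the conjugate
transpose, over every commutative ring, so also over `ℂ`.) -/
def HasOrthogonalLinearPart {n : ℕ} (I : (Fin n → ℂ) →ᵃ[ℂ] (Fin n → ℂ)) : Prop :=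
  LinearMap.toMatrix' I.linear ∈ Matrix.orthogonalGroup (Fin n) ℂ

/-! Conjugating `f` by multiplication by `d` reduces to the case where the form value 1 is
preserved. Two points equidistant from a regular `n`-point base are equal or mirror images in it
(`apex_eq_or`), so new preserved values arise from old ones, and `f` sends mirror pairs to mirror
pairs. This gives `f (x + 2e) + f x = 2 f (x + e)` on steps `e` of preserved length
(`add_two_smul`), hence all rational multiples of the length and, by continuity, all positive real
form values.

So `f` is isometric on real points, and an orthogonal matrix and a translation make it fix all of
them. The form values from `x + iy` to real points then force its image to be `x ± iy`
(`map_complexVec_sub`). The sign is constant because the set `y ≠ 0` is connected for `n ≥ 2`,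
leaving the identity or conjugation. -/

/-! ### The complex quadratic form and its isometries -/

/-- The quadratic form `∑ i, x i ^ 2` on `ℂⁿ`. -/
def sqForm {n : ℕ} (x : Fin n → ℂ) : ℂ := x ⬝ᵥ x

/-- `f` preserves the value `t` of the form `sqForm` on differences. -/
def PreservesForm {n : ℕ} (f : (Fin n → ℂ) → (Fin n → ℂ)) (t : ℂ) : Prop :=
  ∀ x y, sqForm (x - y) = t → sqForm (f x - f y) = t

theorem phi_eq_sqForm {n : ℕ} (X Y : Fin n → ℂ) : phi X Y = sqForm (X - Y) := by
  simp [phi, sqForm, dotProduct, sq]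

theorem sqForm_add {n : ℕ} (x y : Fin n → ℂ) :
    sqForm (x + y) = sqForm x + 2 * (x ⬝ᵥ y) + sqForm y := by
  simp only [sqForm, add_dotProduct, dotProduct_add, dotProduct_comm y x]; ring

theorem sqForm_sub {n : ℕ} (x y : Fin n → ℂ) :
    sqForm (x - y) = sqForm x - 2 * (x ⬝ᵥ y) + sqForm y := by
  simp only [sqForm, sub_dotProduct, dotProduct_sub, dotProduct_comm y x]; ring

theorem sqForm_smul {n : ℕ} (c : ℂ) (x : Fin n → ℂ) : sqForm (c • x) = c ^ 2 * sqForm x := by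
  simp only [sqForm, smul_dotProduct, dotProduct_smul, smul_eq_mul]; ring

theorem sqForm_neg {n : ℕ} (x : Fin n → ℂ) : sqForm (-x) = sqForm x := by
  simp [sqForm]

theorem sqForm_zero {n : ℕ} : sqForm (0 : Fin n → ℂ) = 0 := by
  simp [sqForm]

theorem sqForm_sub_comm {n : ℕ} (x y : Fin n → ℂ) : sqForm (x - y) = sqForm (y - x) := by
  rw [← sqForm_neg, neg_sub]

theorem continuous_sqForm {n : ℕ} : Continuous (sqForm : (Fin n → ℂ) → ℂ) := by
  unfold sqForm dotProduct; fun_prop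

/-- The reflection of `ℂⁿ` along `a`. -/
noncomputable def reflAlong {n : ℕ} (a : Fin n → ℂ) : (Fin n → ℂ) →ₗ[ℂ] (Fin n → ℂ) where
  toFun x := x - (2 * (x ⬝ᵥ a) / sqForm a) • a
  map_add' x y := by
    rw [add_dotProduct, mul_add, add_div, add_smul]; abel
  map_smul' c x := by
    simp only [smul_dotProduct, smul_eq_mul, RingHom.id_apply, smul_sub, smul_smul]
    congr 2; ring

theorem reflAlong_apply {n : ℕ} (a x : Fin n → ℂ) :
    reflAlong a x = x - (2 * (x ⬝ᵥ a) / sqForm a) • a := rfl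

theorem reflAlong_dotProduct {n : ℕ} {a : Fin n → ℂ} (ha : sqForm a ≠ 0) (x y : Fin n → ℂ) :
    reflAlong a x ⬝ᵥ reflAlong a y = x ⬝ᵥ y := by
  have h : a ⬝ᵥ a = sqForm a := rfl
  simp only [reflAlong_apply, sub_dotProduct, dotProduct_sub, smul_dotProduct, dotProduct_smul,
    smul_eq_mul, h, dotProduct_comm a y]
  field_simp; ring

/-- Reflection along `u - v` does it unless `u - v` is isotropic; in that case `u + v` has form
value `4 * sqForm u ≠ 0`, and minus the reflection along it works. -/
theorem exists_isometry_map_eq {n : ℕ} {u v : Fin n → ℂ} (h : sqForm u = sqForm v)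
    (hu : sqForm u ≠ 0) : ∃ O : (Fin n → ℂ) →ₗ[ℂ] (Fin n → ℂ),
      (∀ x y, O x ⬝ᵥ O y = x ⬝ᵥ y) ∧ O u = v := by
  by_cases huv : sqForm (u - v) = 0
  · have h2 : sqForm (u + v) ≠ 0 := by
      rw [sqForm_sub, ← h] at huv
      rw [sqForm_add, ← h, show 2 * (u ⬝ᵥ v) = 2 * sqForm u by linear_combination -huv]
      intro h0; apply hu; linear_combination h0 / 4
    refine ⟨-reflAlong (u + v), fun x y => ?_, ?_⟩
    · simp [reflAlong_dotProduct h2]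
    · have : 2 * (u ⬝ᵥ (u + v)) / sqForm (u + v) = 1 := by
        rw [div_eq_one_iff_eq h2, sqForm_add, dotProduct_add, ← h, sqForm]; ring
      rw [LinearMap.neg_apply, reflAlong_apply, this, one_smul, neg_sub, add_sub_cancel_left]
  · refine ⟨reflAlong (u - v), reflAlong_dotProduct huv, ?_⟩
    have : 2 * (u ⬝ᵥ (u - v)) / sqForm (u - v) = 1 := by
      rw [div_eq_one_iff_eq huv, sqForm_sub, dotProduct_sub, ← h, sqForm]; ring
    rw [reflAlong_apply, this, one_smul, sub_sub_cancel]

theorem exists_sq_eq (t : ℂ) : ∃ c : ℂ, c ^ 2 = t :=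
  IsAlgClosed.exists_pow_nat_eq t two_pos

theorem sqForm_single_add_single {n : ℕ} {i j : Fin n} (hij : i ≠ j) (a b : ℂ) :
    sqForm (Pi.single i a + Pi.single j b) = a ^ 2 + b ^ 2 := by
  simp [sqForm, hij, hij.symm, sq]

theorem exists_sqForm_eq_and_sqForm_sub_eq {n : ℕ} (hn : 2 ≤ n) {w : Fin n → ℂ}
    (hw : sqForm w ≠ 0) (r s : ℂ) : ∃ z, sqForm z = r ∧ sqForm (z - w) = s := by
  obtain ⟨c, hc⟩ := exists_sq_eq (sqForm w)
  have hc0 : c ≠ 0 := by rintro rfl; simp at hc; exact hw hc.symm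
  -- Subtracting `(α - c)² + β² = s` from `α² + β² = r` gives `α = (r + c² - s) / (2c)`.
  obtain ⟨β, hβ⟩ := exists_sq_eq (r - ((r + c ^ 2 - s) / (2 * c)) ^ 2)
  let i : Fin n := ⟨0, by omega⟩
  let j : Fin n := ⟨1, by omega⟩
  have hij : i ≠ j := by simp [i, j]
  have hQ : ∀ a b : ℂ, sqForm (Pi.single i a + Pi.single j b) = a ^ 2 + b ^ 2 :=
    sqForm_single_add_single hij
  have hw0 : sqForm (Pi.single i c + Pi.single j 0) = sqForm w := by rw [hQ, ← hc]; ring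
  obtain ⟨O, hO, hOw⟩ := exists_isometry_map_eq hw0 (by rw [hw0]; exact hw)
  have hOQ : ∀ x, sqForm (O x) = sqForm x := fun x => hO x x
  refine ⟨O (Pi.single i ((r + c ^ 2 - s) / (2 * c) : ℂ) + Pi.single j β), ?_, ?_⟩
  · rw [hOQ, hQ, hβ]; ring
  · rw [← hOw, ← map_sub, hOQ, add_sub_add_comm, ← Pi.single_sub, ← Pi.single_sub, hQ, sub_zero,
      hβ]
    field_simp; ring

/-! ### Regular simplices and their apexes -/

/-- A regular simplex with `n` vertices, of prescribed circumradius, in the complement of `w`. -/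
theorem exists_regular_simplex {n : ℕ} (hn : 2 ≤ n) {w : Fin n → ℂ} (hw : sqForm w ≠ 0) (b : ℂ) :
    ∃ g : Fin n → (Fin n → ℂ), (∀ i, g i ⬝ᵥ w = 0) ∧
      (∀ i, sqForm (g i) = (2 - 2 / (n : ℂ)) * b / 4) ∧
      ∀ i j, i ≠ j → sqForm (g i - g j) = b := by
  have hn0 : (n : ℂ) ≠ 0 := by exact_mod_cast (by omega : n ≠ 0)
  obtain ⟨c, hc⟩ := exists_sq_eq (b / 2)
  obtain ⟨l, hl⟩ := exists_sq_eq (sqForm w / n)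
  have h1 : sqForm (1 : Fin n → ℂ) = n := by simp [sqForm, dotProduct]
  have hw0 : sqForm (l • (1 : Fin n → ℂ)) = sqForm w := by
    rw [sqForm_smul, hl, h1]; field_simp
  obtain ⟨O, hO, hOw⟩ := exists_isometry_map_eq hw0 (by rw [hw0]; exact hw)
  have hOQ : ∀ x, sqForm (O x) = sqForm x := fun x => hO x x
  -- The standard basis centred at its centroid is orthogonal to the all-ones vector; `O` carries a
  -- multiple of that vector to `w`.
  refine ⟨fun i => O (c • (Pi.single i 1 - (1 / (n : ℂ)) • 1)), fun i => ?_, fun i => ?_,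
    fun i j hij => ?_⟩
  · rw [← hOw, hO, smul_dotProduct, dotProduct_smul, sub_dotProduct, smul_dotProduct,
      show (1 : Fin n → ℂ) ⬝ᵥ 1 = n from h1]
    simp [hn0]
  · rw [hOQ, sqForm_smul, hc, sqForm_sub, sqForm_smul, h1]
    simp [sqForm]
    field_simp; ring
  · rw [← map_sub, ← smul_sub, hOQ, sqForm_smul, hc, sub_sub_sub_cancel_right, sub_eq_add_neg,
      ← Pi.single_neg, sqForm_single_add_single hij]
    ring

/-- The two apexes over a regular `n`-point base are equal or mirror images of each other. -/
theorem apex_eq_or {n : ℕ} (hn : 2 ≤ n) {r b : ℂ} (hb : b ≠ 0)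
    (hrb : 4 * r - (2 - 2 / (n : ℂ)) * b ≠ 0) {p : Fin n → (Fin n → ℂ)} {z z' : Fin n → ℂ}
    (hp : ∀ i j, i ≠ j → sqForm (p i - p j) = b) (hz : ∀ i, sqForm (z - p i) = r)
    (hz' : ∀ i, sqForm (z' - p i) = r) :
    z = z' ∨ z + z' = (2 / (n : ℂ)) • ∑ i, p i ∧
      sqForm (z - z') = 4 * r - (2 - 2 / (n : ℂ)) * b := by
  have hn0 : (n : ℂ) ≠ 0 := by exact_mod_cast (by omega : n ≠ 0)
  -- The Gram matrix of the `p i - z` is `b/2` times the identity plus `r - b/2` times the all-ones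
  -- matrix; `γ` is its eigenvalue on constant vectors.
  set γ : ℂ := b / 2 + n * (r - b / 2) with hγ
  have hγn : 4 * γ / n = 4 * r - (2 - 2 / (n : ℂ)) * b := by rw [hγ]; field_simp; ring
  have hγ0 : γ ≠ 0 := by
    intro h; apply hrb; rw [← hγn, h]; simp
  let M : Matrix (Fin n) (Fin n) ℂ := Matrix.of fun i => p i - z
  have hG : ∀ i j, (p i - z) ⬝ᵥ (p j - z) = if i = j then r else r - b / 2 := by
    intro i j
    have h := sqForm_sub (p i - z) (p j - z)
    rw [sub_sub_sub_cancel_right, sqForm_sub_comm (p i) z, sqForm_sub_comm (p j) z, hz, hz] at h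
    split_ifs with hij
    · subst hij; rw [sub_self, sqForm_zero] at h; linear_combination h / 2
    · rw [hp i j hij] at h; linear_combination h / 2
  have hMM : ∀ x : Fin n → ℂ, M.mulVec (M.transpose.mulVec x) =
      fun i => b / 2 * x i + (r - b / 2) * ∑ j, x j := by
    intro x
    ext i
    rw [Matrix.mulVec_mulVec, Matrix.mulVec, dotProduct]
    have : ∀ j, (M * M.transpose) i j = (if i = j then b / 2 else 0) + (r - b / 2) := by
      intro j
      have : (M * M.transpose) i j = (p i - z) ⬝ᵥ (p j - z) := rfl
      rw [this, hG]; split_ifs <;> ring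
    simp [this, add_mul, Finset.sum_add_distrib, Finset.mul_sum]
  have hdet : M.det ≠ 0 := by
    intro h0
    have : M.transpose.det = 0 := by rw [Matrix.det_transpose, h0]
    obtain ⟨x, hx0, hx⟩ := Matrix.exists_mulVec_eq_zero_iff.2 this
    have h1 := hMM x
    rw [hx, Matrix.mulVec_zero] at h1
    have h2 : ∀ i, b / 2 * x i + (r - b / 2) * ∑ j, x j = 0 := fun i => (congrFun h1 i).symm
    have h3 : γ * ∑ j, x j = 0 := by
      have := Finset.sum_congr rfl (fun i (_ : i ∈ Finset.univ) => h2 i)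
      rw [Finset.sum_add_distrib, ← Finset.mul_sum] at this
      simp at this
      rw [hγ]; linear_combination this
    have h4 : ∑ j, x j = 0 := (mul_eq_zero.1 h3).resolve_left hγ0
    apply hx0
    ext i
    have h5 := h2 i
    rw [h4, mul_zero, add_zero] at h5
    exact (mul_eq_zero.1 h5).resolve_left (by simpa using hb)
  set σ : Fin n → ℂ := ∑ i, (p i - z) with hσ
  have hMt : M.transpose.mulVec 1 = σ := by
    ext k
    simp [Matrix.mulVec, dotProduct, hσ, M, Finset.sum_apply]
  have hMσ : M.mulVec σ = fun _ => γ := by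
    rw [← hMt, hMM]; ext i; simp [hγ]; ring
  have hMw : M.mulVec (z' - z) = fun _ => sqForm (z' - z) / 2 := by
    ext i
    have h := sqForm_sub (z' - z) (p i - z)
    rw [sub_sub_sub_cancel_right, hz', sqForm_sub_comm (p i) z, hz, dotProduct_comm] at h
    change (p i - z) ⬝ᵥ (z' - z) = _
    linear_combination h / 2
  -- `M` sends both `z' - z` and `σ` to constant vectors, so injectivity makes them proportional;
  -- comparing form values then gives `μ = 0` or `μ = 2/n`.
  set μ := sqForm (z' - z) / (2 * γ) with hμ
  have hw : z' - z = μ • σ := by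
    have : M.mulVec (z' - z - μ • σ) = 0 := by
      rw [Matrix.mulVec_sub, Matrix.mulVec_smul, hMw, hMσ]
      ext i
      simp [hμ]; field_simp; ring
    exact sub_eq_zero.1 (Matrix.eq_zero_of_mulVec_eq_zero hdet this)
  have hQσ : sqForm σ = n * γ := by
    have : ∀ i, (p i - z) ⬝ᵥ σ = γ := fun i => congrFun hMσ i
    have h2 : sqForm σ = ∑ i, (p i - z) ⬝ᵥ σ := by
      rw [← sum_dotProduct]; rfl
    rw [h2]; simp [this]
  have hμ2 : μ * (n * μ - 2) = 0 := by
    have h1 : sqForm (z' - z) = 2 * γ * μ := by rw [hμ]; field_simp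
    have h2 : sqForm (z' - z) = μ ^ 2 * (n * γ) := by
      conv_lhs => rw [hw, sqForm_smul, hQσ]
    apply mul_left_cancel₀ hγ0
    linear_combination h1 - h2
  rcases mul_eq_zero.1 hμ2 with h | h
  · left; rw [h, zero_smul] at hw; exact (sub_eq_zero.1 hw).symm
  · right
    have hμn : μ = 2 / n := by field_simp; linear_combination h
    constructor
    · rw [hμn, hσ, Finset.sum_sub_distrib, Finset.sum_const, Finset.card_univ, Fintype.card_fin,
        ← Nat.cast_smul_eq_nsmul ℂ, smul_sub, smul_smul, div_mul_cancel₀ _ hn0] at hw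
      rw [sub_eq_iff_eq_add] at hw
      rw [hw, two_smul]; abel
    · rw [sqForm_sub_comm, hw, sqForm_smul, hQσ, hμn, ← hγn]; field_simp; ring
-- The base is a simplex orthogonal to `z - z'`, centred at the midpoint of `z` and `z'`.
theorem exists_apex_base {n : ℕ} (hn : 2 ≤ n) {r b : ℂ}
    (hrb : 4 * r - (2 - 2 / (n : ℂ)) * b ≠ 0) {z z' : Fin n → ℂ}
    (hzz : sqForm (z - z') = 4 * r - (2 - 2 / (n : ℂ)) * b) :
    ∃ p : Fin n → (Fin n → ℂ), (∀ i j, i ≠ j → sqForm (p i - p j) = b) ∧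
      (∀ i, sqForm (z - p i) = r) ∧ ∀ i, sqForm (z' - p i) = r := by
  obtain ⟨g, hgw, hgQ, hgg⟩ := exists_regular_simplex hn (w := z - z') (by rwa [hzz]) b
  have h2 : ∀ c : ℂ, c ^ 2 = 1 / 4 → ∀ i, sqForm (c • (z - z') - g i) = r := by
    intro c hc i
    rw [sqForm_sub, sqForm_smul, hgQ, hzz, smul_dotProduct, dotProduct_comm, hgw, hc, smul_zero]
    ring
  refine ⟨fun i => (1 / 2 : ℂ) • (z + z') + g i, fun i j hij => ?_, fun i => ?_, fun i => ?_⟩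
  · rw [add_sub_add_left_eq_sub, hgg i j hij]
  · rw [← h2 (1 / 2) (by norm_num) i]; congr 1; module
  · rw [← h2 (-1 / 2) (by norm_num) i]; congr 1; module

/-! ### Generating preserved form values -/

namespace PreservesForm

variable {n : ℕ} {f : (Fin n → ℂ) → (Fin n → ℂ)}

/-- Let `h` be the value in `hzz`. If `h = b`, it is preserved and nonzero. Otherwise rotate `z'`
about `z` to a point at value `b` from the old `z'`. If `f z = f z'`, its image has value `b` from
`f z`, whereas `apex_eq_or` allows only `0` or `h`. -/
theorem apex_ne (hn : 2 ≤ n) {r b : ℂ} (hr : PreservesForm f r) (hb : PreservesForm f b)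
    (hb0 : b ≠ 0) (hrb : 4 * r - (2 - 2 / (n : ℂ)) * b ≠ 0) {z z' : Fin n → ℂ}
    (hzz : sqForm (z - z') = 4 * r - (2 - 2 / (n : ℂ)) * b) : f z ≠ f z' := by
  intro heq
  by_cases hbt : 4 * r - (2 - 2 / (n : ℂ)) * b = b
  · have := hb _ _ (hzz.trans hbt)
    rw [heq, sub_self, sqForm_zero] at this
    exact hb0 this.symm
  obtain ⟨y, hy, hy'⟩ := exists_sqForm_eq_and_sqForm_sub_eq hn (w := z' - z)
    (by rwa [sqForm_sub_comm, hzz]) (4 * r - (2 - 2 / (n : ℂ)) * b) b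
  have h1 : sqForm (f (z + y) - f z) = b := by
    rw [heq]; apply hb; rw [← hy']; congr 1; abel
  have hy2 : sqForm (z + y - z) = 4 * r - (2 - 2 / (n : ℂ)) * b := by
    rw [← hy]; congr 1; abel
  obtain ⟨p, hp, hz, hz'⟩ := exists_apex_base hn hrb hy2
  rcases apex_eq_or hn hb0 hrb (fun i j hij => hb _ _ (hp i j hij))
    (fun i => hr _ _ (hz i)) (fun i => hr _ _ (hz' i)) with h | h
  · rw [h, sub_self, sqForm_zero] at h1; exact hb0 h1.symm
  · exact hbt (h.2.symm.trans h1)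

theorem apex (hn : 2 ≤ n) {r b : ℂ} (hr : PreservesForm f r) (hb : PreservesForm f b)
    (hb0 : b ≠ 0) (hrb : 4 * r - (2 - 2 / (n : ℂ)) * b ≠ 0) :
    PreservesForm f (4 * r - (2 - 2 / (n : ℂ)) * b) := by
  intro z z' hzz
  obtain ⟨p, hp, hz, hz'⟩ := exists_apex_base hn hrb hzz
  exact ((apex_eq_or hn hb0 hrb (fun i j hij => hb _ _ (hp i j hij))
    (fun i => hr _ _ (hz i)) (fun i => hr _ _ (hz' i))).resolve_left
      (apex_ne hn hr hb hb0 hrb hzz)).2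

/-- Apexes over a regular `n`-point base are mapped to points symmetric about the centroid of the
image of the base. -/
theorem map_apex_add (hn : 2 ≤ n) {r b : ℂ} (hr : PreservesForm f r) (hb : PreservesForm f b)
    (hb0 : b ≠ 0) (hrb : 4 * r - (2 - 2 / (n : ℂ)) * b ≠ 0) {p : Fin n → (Fin n → ℂ)}
    {z z' : Fin n → ℂ} (hp : ∀ i j, i ≠ j → sqForm (p i - p j) = b)
    (hz : ∀ i, sqForm (z - p i) = r) (hz' : ∀ i, sqForm (z' - p i) = r) (hne : z ≠ z') :
    f z + f z' = (2 / (n : ℂ)) • ∑ i, f (p i) :=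
  ((apex_eq_or hn hb0 hrb (fun i j hij => hb _ _ (hp i j hij))
    (fun i => hr _ _ (hz i)) (fun i => hr _ _ (hz' i))).resolve_left
      (apex_ne hn hr hb hb0 hrb ((apex_eq_or hn hb0 hrb hp hz hz').resolve_left hne).2)).1

/-- Apply `apex` twice: first with base value `t`, then with base value `2(n+1)/n * t`. The factor
is below 1 exactly when `n ≥ 3`, so the plane needs a separate argument later. -/
theorem mul_two_div_sq (hn : 2 ≤ n) {t : ℂ} (ht : PreservesForm f t) (ht0 : t ≠ 0) :
    PreservesForm f ((2 / (n : ℂ)) ^ 2 * t) := by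
  have hn0 : (n : ℂ) ≠ 0 := by exact_mod_cast (by omega : n ≠ 0)
  have hn1 : (n : ℂ) + 1 ≠ 0 := by exact_mod_cast (by omega : n + 1 ≠ 0)
  have e1 : 4 * t - (2 - 2 / (n : ℂ)) * t = 2 * (n + 1) / n * t := by field_simp; ring
  have h1 : 4 * t - (2 - 2 / (n : ℂ)) * t ≠ 0 := by
    rw [e1]; simp [hn0, hn1, ht0]
  have e2 : 4 * t - (2 - 2 / (n : ℂ)) * (4 * t - (2 - 2 / (n : ℂ)) * t) =
      (2 / (n : ℂ)) ^ 2 * t := by ring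
  rw [← e2]
  refine apex hn ht (apex hn ht ht ht0 h1) h1 ?_
  rw [e2]; simp [hn0, ht0]

theorem pow_two_div_sq_mul (hn : 2 ≤ n) {t : ℂ} (ht : PreservesForm f t) (ht0 : t ≠ 0) (k : ℕ) :
    PreservesForm f (((2 / (n : ℂ)) ^ k) ^ 2 * t) := by
  have hn0 : (n : ℂ) ≠ 0 := by exact_mod_cast (by omega : n ≠ 0)
  induction k with
  | zero => simpa using ht
  | succ k ih =>
    have := mul_two_div_sq hn ih (by simp [hn0, ht0])
    rwa [← mul_assoc, ← mul_pow, ← pow_succ'] at this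

/-- For `n = 2` the apex property says that `f` maps rhombi made of two equilateral triangles to
parallelograms; adding the relations of two such overlapping rhombi gives the claim. -/
theorem add_two_smul_of_two {f : (Fin 2 → ℂ) → (Fin 2 → ℂ)} {t : ℂ} (ht : PreservesForm f t)
    (ht0 : t ≠ 0) {e : Fin 2 → ℂ} (he : sqForm e = t) (x : Fin 2 → ℂ) :
    f (x + (2 : ℂ) • e) + f x = (2 : ℂ) • f (x + e) := by
  obtain ⟨a, ha, hae⟩ := exists_sqForm_eq_and_sqForm_sub_eq le_rfl (by rwa [he] : sqForm e ≠ 0) t t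
  have hrb : 4 * t - (2 - 2 / ((2 : ℕ) : ℂ)) * t ≠ 0 := by
    have : 4 * t - (2 - 2 / ((2 : ℕ) : ℂ)) * t = 3 * t := by push_cast; ring
    rw [this]; simp [ht0]
  have key : ∀ (x u v : Fin 2 → ℂ), sqForm u = t → sqForm v = t → sqForm (u - v) = t →
      f x + f (x + u + v) = f (x + u) + f (x + v) := by
    intro x u v hu hv huv
    have huv' : sqForm (u + v) ≠ 0 := by
      rw [sqForm_add]; rw [sqForm_sub] at huv
      have : sqForm u + 2 * u ⬝ᵥ v + sqForm v = 3 * t := by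
        linear_combination 2 * hu + 2 * hv - huv
      rw [this]; simp [ht0]
    have hneg : ∀ w y : Fin 2 → ℂ, w = -y → sqForm y = t → sqForm w = t := by
      rintro _ y rfl h; rwa [sqForm_neg]
    have := map_apex_add le_rfl ht ht ht0 hrb (p := ![x + u, x + v]) (z := x) (z' := x + u + v)
      (by
        intro i j hij
        fin_cases i <;> fin_cases j <;> simp at hij ⊢
        · exact huv
        · rwa [sqForm_sub_comm])
      (by
        intro i
        fin_cases i
        · exact hneg _ u (by simp) hu
        · exact hneg _ v (by simp) hv)
      (by
        intro i
        fin_cases i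
        · simpa using hv
        · rw [← hu]; congr 1; simp)
      (by
        intro h
        apply huv'
        have : u + v = 0 := by rwa [add_assoc, left_eq_add] at h
        rw [this, sqForm_zero])
    simpa using this
  have hea : sqForm (e - a) = t := by rwa [sqForm_sub_comm]
  have h1 := key x e a he ha hea
  have h2 := key (x + a) (e - a) e hea he (by rw [← ha, ← sqForm_neg]; congr 1; abel)
  rw [show x + a + (e - a) + e = x + (2 : ℂ) • e by module,
    show x + a + (e - a) = x + e by abel, show x + a + e = x + e + a by abel] at h2
  rw [two_smul ℂ (f (x + e))]
  linear_combination (exp := 1) h1 + h2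

/-- Bases of size `(2/n)^k` shrink to the midpoint `x + e` while their apexes tend to `x` and `x +
2e`; the mirror relation passes to the limit. -/
theorem add_two_smul_of_three_le (hf : Continuous f) (hn : 3 ≤ n) {t : ℂ}
    (ht : PreservesForm f t) (ht0 : t ≠ 0) {e : Fin n → ℂ} (he : sqForm e = t) (x : Fin n → ℂ) :
    f (x + (2 : ℂ) • e) + f x = (2 : ℂ) • f (x + e) := by
  have hn0 : (n : ℂ) ≠ 0 := by exact_mod_cast (by omega : n ≠ 0)
  have hnR : (3 : ℝ) ≤ n := by exact_mod_cast hn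
  obtain ⟨g, hge, hgQ, hgg⟩ := exists_regular_simplex (by omega) (by rwa [he] : sqForm e ≠ 0) t
  -- Half-height factor that keeps the value from apex to base vertex equal to `t` when the base is
  -- scaled by `δ`.
  let s : ℝ → ℝ := fun δ => √(1 - (2 - 2 / (n : ℝ)) / 4 * δ ^ 2)
  have hs : Continuous s := by fun_prop
  have hs0 : s 0 = 1 := by simp [s]
  let Ψ : ℝ → (Fin n → ℂ) := fun δ => f (x + (2 : ℂ) • ((s δ : ℂ) • e)) + f x -
    (2 / (n : ℂ)) • ∑ i, f (x + (s δ : ℂ) • e + (δ : ℂ) • g i)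
  have hΨ : Continuous Ψ := by fun_prop
  have hδ : Filter.Tendsto (fun k : ℕ => (2 / (n : ℝ)) ^ k) Filter.atTop (nhds 0) :=
    tendsto_pow_atTop_nhds_zero_of_lt_one (by positivity) (by
      rw [div_lt_one (by positivity)]; linarith)
  have hΨk : ∀ k : ℕ, Ψ ((2 / (n : ℝ)) ^ k) = 0 := by
    intro k
    set δ : ℝ := (2 / (n : ℝ)) ^ k with hδk
    have hδ0 : 0 < δ := by positivity
    have hδ1 : δ ≤ 1 := pow_le_one₀ (by positivity) (by
      rw [div_le_one (by positivity)]; linarith)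
    have hpos : 0 < 1 - (2 - 2 / (n : ℝ)) / 4 * δ ^ 2 := by
      have : 0 < 2 / (n : ℝ) := by positivity
      nlinarith [sq_nonneg δ]
    have hs2 : ((s δ : ℝ) : ℂ) ^ 2 = 1 - (2 - 2 / (n : ℂ)) / 4 * (δ : ℂ) ^ 2 := by
      have : (s δ) ^ 2 = 1 - (2 - 2 / (n : ℝ)) / 4 * δ ^ 2 := Real.sq_sqrt hpos.le
      have := congrArg Complex.ofReal this
      push_cast at this; exact this
    have hsδ : ((s δ : ℝ) : ℂ) ≠ 0 := by
      exact_mod_cast (Real.sqrt_pos.2 hpos).ne'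
    have hδC : (δ : ℂ) ≠ 0 := by exact_mod_cast hδ0.ne'
    have hb : PreservesForm f ((δ : ℂ) ^ 2 * t) := by
      have := pow_two_div_sq_mul (by omega) ht ht0 k
      rw [hδk]; push_cast; exact this
    have hr : ∀ c : ℂ, c ^ 2 = (s δ : ℂ) ^ 2 → ∀ i, sqForm (c • e - (δ : ℂ) • g i) = t := by
      intro c hc i
      rw [sqForm_sub, sqForm_smul, sqForm_smul, he, hgQ, smul_dotProduct, dotProduct_smul,
        dotProduct_comm, hge, hc, hs2]
      simp only [smul_eq_mul]; ring
    have hQe : 4 * t - (2 - 2 / (n : ℂ)) * ((δ : ℂ) ^ 2 * t) = 4 * (s δ : ℂ) ^ 2 * t := by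
      rw [hs2]; ring
    have := map_apex_add (by omega) ht hb (by simp [hδC, ht0]) (by rw [hQe]; simp [hsδ, ht0])
      (p := fun i => x + (s δ : ℂ) • e + (δ : ℂ) • g i) (z := x + (2 : ℂ) • ((s δ : ℂ) • e))
      (z' := x)
      (by
        intro i j hij
        rw [add_sub_add_left_eq_sub, ← smul_sub, sqForm_smul, hgg i j hij])
      (by
        intro i
        rw [← hr (s δ) rfl i]; congr 1; module)
      (by
        intro i
        rw [← hr (-s δ) (by ring) i]; congr 1; module)
      (by
        intro h
        rw [add_eq_left, smul_smul] at h
        rcases smul_eq_zero.1 h with h | h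
        · exact hsδ (by simpa using h)
        · rw [h, sqForm_zero] at he; exact ht0 he.symm)
    exact sub_eq_zero.2 this
  have hlim : Ψ 0 = 0 := by
    have h1 := (hΨ.tendsto 0).comp hδ
    have h2 : Ψ ∘ (fun k : ℕ => (2 / (n : ℝ)) ^ k) = fun _ => 0 := funext hΨk
    rw [h2] at h1
    exact tendsto_nhds_unique h1 tendsto_const_nhds
  have : Ψ 0 = f (x + (2 : ℂ) • e) + f x - (2 : ℂ) • f (x + e) := by
    simp only [Ψ, hs0, Complex.ofReal_one, one_smul, Complex.ofReal_zero, zero_smul, add_zero, mul_one,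
      Finset.sum_const, Finset.card_univ, Fintype.card_fin, ← Nat.cast_smul_eq_nsmul ℂ, smul_smul,
      div_mul_cancel₀ _ hn0]
  rw [← sub_eq_zero, ← this, hlim]

theorem add_two_smul (hf : Continuous f) (hn : 2 ≤ n) {t : ℂ}
    (ht : PreservesForm f t) (ht0 : t ≠ 0) {e : Fin n → ℂ} (he : sqForm e = t) (x : Fin n → ℂ) :
    f (x + (2 : ℂ) • e) + f x = (2 : ℂ) • f (x + e) := by
  rcases hn.eq_or_lt with rfl | h
  · exact add_two_smul_of_two ht ht0 he x
  · exact add_two_smul_of_three_le hf h ht ht0 he x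

theorem add_natCast_smul (hf : Continuous f) (hn : 2 ≤ n) {t : ℂ}
    (ht : PreservesForm f t) (ht0 : t ≠ 0) {e : Fin n → ℂ} (he : sqForm e = t) (x : Fin n → ℂ)
    (k : ℕ) : f (x + (k : ℂ) • e) = f x + (k : ℂ) • (f (x + e) - f x) := by
  induction k using Nat.twoStepInduction with
  | zero => simp
  | one => simp
  | more k ih1 ih2 =>
    have := add_two_smul hf hn ht ht0 he (x + (k : ℂ) • e)
    rw [show x + (k : ℂ) • e + e = x + ((k + 1 : ℕ) : ℂ) • e by push_cast; module,
      show x + (k : ℂ) • e + (2 : ℂ) • e = x + ((k + 2 : ℕ) : ℂ) • e by push_cast; module,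
      ih1, ih2] at this
    rw [eq_sub_of_add_eq this]; push_cast; module

theorem natCast_sq_mul (hf : Continuous f) (hn : 2 ≤ n) {t : ℂ}
    (ht : PreservesForm f t) (ht0 : t ≠ 0) {k : ℕ} (hk : k ≠ 0) :
    PreservesForm f ((k : ℂ) ^ 2 * t) := by
  intro x y hxy
  have hk0 : (k : ℂ) ≠ 0 := by exact_mod_cast hk
  set e := (k : ℂ)⁻¹ • (x - y) with hedef
  have he : sqForm e = t := by rw [hedef, sqForm_smul, hxy]; field_simp
  have h := add_natCast_smul hf hn ht ht0 he y k
  rw [show y + (k : ℂ) • e = x by rw [hedef, smul_inv_smul₀ hk0]; abel] at h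
  rw [h, add_sub_cancel_left, sqForm_smul, ht _ _ (by rw [add_sub_cancel_left, he])]

/-- Intercept theorem: make `x` and `y` the base of an isosceles triangle with leg value `t` and
extend the legs `k` times. The extended base has the preserved value `t`, and the images of the legs
extend in the same ratio. -/
theorem div_natCast_sq (hf : Continuous f) (hn : 2 ≤ n) {t : ℂ}
    (ht : PreservesForm f t) (ht0 : t ≠ 0) {k : ℕ} (hk : k ≠ 0) :
    PreservesForm f (t / (k : ℂ) ^ 2) := by
  intro x y hxy
  have hk0 : (k : ℂ) ≠ 0 := by exact_mod_cast hk
  obtain ⟨u, hu, hv⟩ := exists_sqForm_eq_and_sqForm_sub_eq hn (w := x - y)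
    (by rw [hxy]; simp [ht0, hk0]) t t
  set v := u - (x - y) with hvdef
  have h1 := add_natCast_smul hf hn ht ht0 (by rwa [sqForm_neg] : sqForm (-v) = t) (x := y + u) k
  have h2 := add_natCast_smul hf hn ht ht0 (by rwa [sqForm_neg] : sqForm (-u) = t) (x := y + u) k
  have h3 : sqForm (f (y + u + (k : ℂ) • -v) - f (y + u + (k : ℂ) • -u)) = t := by
    apply ht
    rw [show y + u + (k : ℂ) • -v - (y + u + (k : ℂ) • -u) = (k : ℂ) • (x - y) by
      rw [hvdef]; module, sqForm_smul, hxy]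
    field_simp
  rw [h1, h2, add_sub_add_left_eq_sub, ← smul_sub, sub_sub_sub_cancel_right, sqForm_smul,
    show y + u + -v = x by rw [hvdef]; abel, show y + u + -u = y by abel] at h3
  rw [← h3]; field_simp

theorem ofReal_sq (hf : Continuous f) (hn : 2 ≤ n) (h1 : PreservesForm f 1) {s : ℝ}
    (hs : s ≠ 0) : PreservesForm f ((s : ℂ) ^ 2) := by
  have hrat : ∀ q : ℚ, q ≠ 0 → PreservesForm f ((q : ℂ) ^ 2) := by
    intro q hq
    have hd : (q.den : ℂ) ≠ 0 := by exact_mod_cast q.den_nz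
    have := natCast_sq_mul hf hn (div_natCast_sq hf hn h1 one_ne_zero q.den_nz)
      (by simp) (k := q.num.natAbs) (by simpa using hq)
    have e : ((q.num.natAbs : ℕ) : ℂ) ^ 2 = (q.num : ℂ) ^ 2 := by
      rw [← Int.cast_natCast, ← Int.cast_pow, Int.natAbs_sq, Int.cast_pow]
    rwa [e, mul_one_div, ← div_pow, ← Rat.cast_def] at this
  intro x y hxy
  have hs0 : (s : ℂ) ≠ 0 := by exact_mod_cast hs
  set e := (s : ℂ)⁻¹ • (x - y) with hedef
  have he : sqForm e = 1 := by rw [hedef, sqForm_smul, hxy]; field_simp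
  have hx : y + (s : ℂ) • e = x := by rw [hedef, smul_inv_smul₀ hs0]; abel
  -- Both sides are continuous in `a` and agree at rationals.
  have key : (fun a : ℝ => sqForm (f (y + (a : ℂ) • e) - f y)) = fun a : ℝ => (a : ℂ) ^ 2 := by
    refine Rat.denseRange_cast.equalizer (continuous_sqForm.comp (by fun_prop)) (by fun_prop) ?_
    funext q
    by_cases hq : q = 0
    · simp [hq, sqForm_zero]
    · simp only [Function.comp, Complex.ofReal_ratCast]
      apply hrat q hq
      rw [add_sub_cancel_left, sqForm_smul, he, mul_one]
  have := congrFun key s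
  rwa [hx] at this

end PreservesForm
-- Real points and the choice between identity and conjugation
/-- The vector `x + i y` of `ℂⁿ` with real part `x` and imaginary part `y`. -/
noncomputable def complexVec {n : ℕ} (x y : Fin n → ℝ) : Fin n → ℂ :=
  fun i => (x i : ℂ) + Complex.I * (y i : ℂ)

theorem sqForm_complexVec {n : ℕ} (x y : Fin n → ℝ) :
    sqForm (complexVec x y) = ((x ⬝ᵥ x - y ⬝ᵥ y : ℝ) : ℂ) + 2 * Complex.I * ((x ⬝ᵥ y : ℝ) : ℂ) := by
  simp only [sqForm, complexVec, dotProduct, Complex.ofReal_sub, Complex.ofReal_sum,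
    Complex.ofReal_mul, Finset.mul_sum, ← Finset.sum_sub_distrib, ← Finset.sum_add_distrib]
  refine Finset.sum_congr rfl fun i _ => ?_
  linear_combination (y i : ℂ) ^ 2 * Complex.I_sq

theorem complexVec_sub {n : ℕ} (x y x' y' : Fin n → ℝ) :
    complexVec x y - complexVec x' y' = complexVec (x - x') (y - y') := by
  ext i; simp [complexVec]; ring

theorem PreservesForm.sqForm_sub_eq {n : ℕ} {f : (Fin n → ℂ) → (Fin n → ℂ)} (hf : Continuous f)
    (hn : 2 ≤ n) (h1 : PreservesForm f 1) {X Y : Fin n → ℂ} {t : ℝ} (ht : 0 < t)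
    (h : sqForm (X - Y) = t) : sqForm (f X - f Y) = t := by
  have := ofReal_sq hf hn h1 (Real.sqrt_ne_zero'.2 ht)
  rw [← Complex.ofReal_pow, Real.sq_sqrt ht.le] at this
  exact this X Y h

theorem PreservesForm.sqForm_sub_of_real {n : ℕ} {f : (Fin n → ℂ) → (Fin n → ℂ)}
    (hf : Continuous f) (hn : 2 ≤ n) (h1 : PreservesForm f 1) (x y : Fin n → ℝ) :
    sqForm (f (complexVec x 0) - f (complexVec y 0)) = (((x - y) ⬝ᵥ (x - y) : ℝ) : ℂ) := by
  by_cases hxy : x = y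
  · simp [hxy, sqForm_zero]
  · refine sqForm_sub_eq hf hn h1 ?_ ?_
    · exact lt_of_le_of_ne (Finset.sum_nonneg fun i _ => mul_self_nonneg _)
        (Ne.symm (dotProduct_self_eq_zero.not.2 (sub_ne_zero.2 hxy)))
    · rw [complexVec_sub, sqForm_complexVec]; simp

section

variable {n : ℕ} {g : (Fin n → ℂ) → (Fin n → ℂ)}

/-- A point at the same distance from sufficiently many real points as `x + i y` differs from `x`
by a vector proportional to `y`, of the same length as `i y`. -/
theorem map_complexVec_sub (hg : Continuous g) (hn : 2 ≤ n) (h1 : PreservesForm g 1)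
    (hreal : ∀ x : Fin n → ℝ, g (complexVec x 0) = complexVec x 0) (x y : Fin n → ℝ)
    (hy : y ≠ 0) :
    ∃ l : ℂ, l ^ 2 = -1 ∧ g (complexVec x y) - complexVec x 0 = l • fun i => (y i : ℂ) := by
  set h := g (complexVec x y) - complexVec x 0 with hh
  have hyy : 0 < y ⬝ᵥ y := lt_of_le_of_ne
    (Finset.sum_nonneg fun i _ => mul_self_nonneg _)
    (Ne.symm (dotProduct_self_eq_zero.not.2 hy))
  -- The value from `x + iy` to the real points `x ± s` is `s ⬝ᵥ s - y ⬝ᵥ y > 0`, hence preserved;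
  -- the two signs separate the square from the cross term.
  have key : ∀ s : Fin n → ℝ, s ⬝ᵥ y = 0 → y ⬝ᵥ y < s ⬝ᵥ s →
      sqForm h = -((y ⬝ᵥ y : ℝ) : ℂ) ∧ h ⬝ᵥ (fun i => (s i : ℂ)) = 0 := by
    have aux : ∀ s : Fin n → ℝ, s ⬝ᵥ y = 0 → y ⬝ᵥ y < s ⬝ᵥ s →
        sqForm h - 2 * h ⬝ᵥ (fun i => (s i : ℂ)) = -((y ⬝ᵥ y : ℝ) : ℂ) := by
      intro s hs hlt
      have h2 := h1.sqForm_sub_eq hg hn (X := complexVec x y) (Y := complexVec (x + s) 0)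
        (sub_pos.2 hlt) (by
          rw [complexVec_sub, sqForm_complexVec]
          simp [hs])
      have e : complexVec (x + s) 0 = complexVec x 0 + fun i => (s i : ℂ) := by
        ext i; simp [complexVec]
      have e2 : sqForm (fun i => (s i : ℂ)) = ((s ⬝ᵥ s : ℝ) : ℂ) := by
        simp [sqForm, dotProduct]
      rw [hreal, e, ← sub_sub, ← hh, sqForm_sub, e2] at h2
      push_cast at h2 ⊢
      linear_combination h2
    intro s hs hlt
    have a1 := aux s hs hlt
    have a2 := aux (-s) (by simp [hs]) (by simpa using hlt)
    have e : (fun i => (((-s) i : ℝ) : ℂ)) = -fun i => (s i : ℂ) := by ext i; simp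
    rw [e, dotProduct_neg] at a2
    constructor
    · linear_combination (a1 + a2) / 2
    · linear_combination (a2 - a1) / 4
  obtain ⟨i, hi⟩ := Function.ne_iff.1 hy
  have hi : y i ≠ 0 := hi
  have hiC : (y i : ℂ) ≠ 0 := by exact_mod_cast hi
  have key2 : ∀ j, j ≠ i → sqForm h = -((y ⬝ᵥ y : ℝ) : ℂ) ∧ y j * h i = y i * h j := by
    intro j hj
    have hp : 0 < y j ^ 2 + y i ^ 2 := by positivity
    -- `T` makes the vector `T (y_j e_i - y_i e_j)`, orthogonal to `y`, long enough for `key`.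
    obtain ⟨T, hT1, hT⟩ : ∃ T : ℝ, 1 ≤ T ∧ y ⬝ᵥ y < T * (y j ^ 2 + y i ^ 2) :=
      ⟨y ⬝ᵥ y / (y j ^ 2 + y i ^ 2) + 1, by
        have : 0 ≤ y ⬝ᵥ y / (y j ^ 2 + y i ^ 2) := by positivity
        linarith, by rw [add_mul, div_mul_cancel₀ _ hp.ne']; linarith⟩
    have hTC : (T : ℂ) ≠ 0 := by exact_mod_cast (by linarith : T ≠ 0)
    obtain ⟨k1, k2⟩ := key (Pi.single i (T * y j) + Pi.single j (-(T * y i)))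
      (by simp [add_dotProduct]; ring)
      (by
        simp [hj, hj.symm]
        nlinarith [mul_le_mul_of_nonneg_right hT1 (mul_nonneg (by linarith : 0 ≤ T) hp.le)])
    refine ⟨k1, ?_⟩
    have e : (fun k => (((Pi.single i (T * y j) + Pi.single j (-(T * y i)) : Fin n → ℝ) k : ℝ) : ℂ))
        = Pi.single i ((T : ℂ) * y j) + Pi.single j (-((T : ℂ) * y i)) := by
      ext k
      simp only [Pi.add_apply, Pi.single_apply]
      split_ifs <;> simp
    rw [e] at k2
    simp [dotProduct_add] at k2
    apply mul_left_cancel₀ hTC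
    linear_combination k2
  have hl : h = (h i / y i) • fun i => (y i : ℂ) := by
    ext j
    by_cases hj : j = i
    · subst hj; simp; field_simp
    · have := (key2 j hj).2
      simp; field_simp; linear_combination -this
  refine ⟨h i / y i, ?_, hl⟩
  have : Nontrivial (Fin n) := Fin.nontrivial_iff_two_le.2 hn
  obtain ⟨j, hj⟩ := exists_ne i
  have h3 := (key2 j hj).1
  have e2 : sqForm (fun i => (y i : ℂ)) = ((y ⬝ᵥ y : ℝ) : ℂ) := by
    simp [sqForm, dotProduct]
  rw [hl, sqForm_smul, e2] at h3
  have hyC : ((y ⬝ᵥ y : ℝ) : ℂ) ≠ 0 := by exact_mod_cast hyy.ne'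
  apply mul_right_cancel₀ hyC
  rw [h3]; ring

theorem eq_id_or_conj_of_real (hg : Continuous g) (hn : 2 ≤ n) (h1 : PreservesForm g 1)
    (hreal : ∀ x : Fin n → ℝ, g (complexVec x 0) = complexVec x 0) :
    (∀ X, g X = X) ∨ ∀ X, g X = fun i => (starRingEnd ℂ) (X i) := by
  have : Nonempty (Fin n) := ⟨⟨0, by omega⟩⟩
  let P : Set ((Fin n → ℝ) × (Fin n → ℝ)) := Set.univ ×ˢ {0}ᶜ
  have hP : IsPreconnected P := by
    refine isPreconnected_univ.prod (isConnected_compl_singleton_of_one_lt_rank ?_ 0).isPreconnected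
    rw [rank_fin_fun]; exact_mod_cast hn
  -- `F` equals `l * (y ⬝ᵥ y)`, so it records the sign of `l = ±I` continuously; `F² = G²` with `G ≠
  -- 0` on a connected set fixes that sign.
  let F : (Fin n → ℝ) × (Fin n → ℝ) → ℂ := fun p =>
    (g (complexVec p.1 p.2) - complexVec p.1 0) ⬝ᵥ fun i => (p.2 i : ℂ)
  let G : (Fin n → ℝ) × (Fin n → ℝ) → ℂ := fun p => Complex.I * ((p.2 ⬝ᵥ p.2 : ℝ) : ℂ)
  have e2 : ∀ y : Fin n → ℝ,
      (fun i => (y i : ℂ)) ⬝ᵥ (fun i => (y i : ℂ)) = ((y ⬝ᵥ y : ℝ) : ℂ) := by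
    intro y; simp [dotProduct]
  have hne : ∀ y : Fin n → ℝ, y ≠ 0 → ((y ⬝ᵥ y : ℝ) : ℂ) ≠ 0 := by
    intro y hy; exact_mod_cast dotProduct_self_eq_zero.not.2 hy
  have hc : Continuous fun p : (Fin n → ℝ) × (Fin n → ℝ) => g (complexVec p.1 p.2) :=
    hg.comp (by unfold complexVec; fun_prop)
  have hF : Continuous F := by
    simp only [F, dotProduct, Pi.sub_apply]
    refine continuous_finsetSum _ fun i _ => ?_
    refine Continuous.mul (((continuous_apply i).comp hc).sub ?_) (by fun_prop)
    unfold complexVec; fun_prop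
  have hG : Continuous G := by simp only [G, dotProduct]; fun_prop
  have hsq : Set.EqOn (F ^ 2) (G ^ 2) P := by
    rintro ⟨x, y⟩ hxy
    obtain ⟨l, hl, h⟩ := map_complexVec_sub hg hn h1 hreal x y hxy.2
    simp only [Pi.pow_apply, F, G, h, smul_dotProduct, e2, smul_eq_mul, mul_pow, hl, Complex.I_sq]
  have hG0 : ∀ {p}, p ∈ P → G p ≠ 0 := fun {p} hp => mul_ne_zero Complex.I_ne_zero (hne _ hp.2)
  have hfin : ∀ c : ℂ, Set.EqOn F (fun p => c * ((p.2 ⬝ᵥ p.2 : ℝ) : ℂ)) P →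
      ∀ x y : Fin n → ℝ, g (complexVec x y) = complexVec x 0 + c • fun i => (y i : ℂ) := by
    intro c hc x y
    by_cases hy : y = 0
    · subst hy; rw [hreal]; ext i; simp
    · obtain ⟨l, -, h⟩ := map_complexVec_sub hg hn h1 hreal x y hy
      have h3 := hc (x := (x, y)) ⟨trivial, hy⟩
      simp only [F, h, smul_dotProduct, e2, smul_eq_mul] at h3
      rw [← mul_right_cancel₀ (hne y hy) h3, ← h]; abel
  have hX : ∀ X : Fin n → ℂ, X = complexVec (fun i => (X i).re) (fun i => (X i).im) := by
    intro X; ext i; simp only [complexVec]; rw [mul_comm]; exact (Complex.re_add_im _).symm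
  rcases hP.eq_or_eq_neg_of_sq_eq hF.continuousOn hG.continuousOn hsq hG0 with h | h
  · left
    intro X
    conv_lhs => rw [hX X]
    rw [hfin Complex.I h]
    conv_rhs => rw [hX X]
    ext i; simp [complexVec]
  · right
    intro X
    conv_lhs => rw [hX X]
    rw [hfin (-Complex.I) (by intro p hp; rw [h hp]; simp [G])]
    ext i
    apply Complex.ext <;> simp [complexVec]

/-- Polarization on real points shows that the vectors `f e_i - f 0` are orthonormal and give `f x -
f 0` the coordinates of `x`; the matrix `B` with these rows reduces to a map fixing real points. -/
theorem exists_orthogonal_of_preservesForm_one {f : (Fin n → ℂ) → (Fin n → ℂ)} (hf : Continuous f)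
    (hn : 2 ≤ n) (h1 : PreservesForm f 1) :
    ∃ A : Matrix (Fin n) (Fin n) ℂ, A * A.transpose = 1 ∧
      ((∀ X, f X = A.mulVec X + f 0) ∨
        ∀ X, f X = A.mulVec (fun i => (starRingEnd ℂ) (X i)) + f 0) := by
  let B : Matrix (Fin n) (Fin n) ℂ := Matrix.of fun i => f (Pi.single i 1) - f 0
  have e0 : (0 : Fin n → ℂ) = complexVec 0 0 := by ext i; simp [complexVec]
  have es : ∀ i : Fin n, (Pi.single i 1 : Fin n → ℂ) = complexVec (Pi.single i 1) 0 := by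
    intro i; ext j; simp only [complexVec, Pi.single_apply]; split_ifs <;> simp
  have hdot : ∀ (x : Fin n → ℝ) (i : Fin n),
      (f (Pi.single i 1) - f 0) ⬝ᵥ (f (complexVec x 0) - f 0) = x i := by
    intro x i
    have h := sqForm_sub (f (complexVec x 0) - f 0) (f (Pi.single i 1) - f 0)
    rw [sub_sub_sub_cancel_right, e0, es, h1.sqForm_sub_of_real hf hn, h1.sqForm_sub_of_real hf hn,
      h1.sqForm_sub_of_real hf hn] at h
    rw [dotProduct_comm, e0, es]
    generalize (f (complexVec x 0) - f (complexVec 0 0)) ⬝ᵥ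
      (f (complexVec (Pi.single i 1) 0) - f (complexVec 0 0)) = c at h ⊢
    simp [sub_dotProduct, dotProduct_sub] at h
    linear_combination h / 2
  have hBx : ∀ x : Fin n → ℝ, B.mulVec (f (complexVec x 0) - f 0) = complexVec x 0 := by
    intro x; ext i
    rw [show complexVec x 0 i = x i by simp [complexVec]]
    exact hdot x i
  have hBB : B * B.transpose = 1 := by
    ext i j
    change (f (Pi.single i 1) - f 0) ⬝ᵥ (f (Pi.single j 1) - f 0) = _
    rw [es j, hdot, Matrix.one_apply, Pi.single_apply]
    split_ifs <;> simp
  have hBB' : B.transpose * B = 1 := mul_eq_one_comm.1 hBB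
  have hQ : ∀ v, sqForm (B.mulVec v) = sqForm v := by
    intro v
    rw [sqForm, Matrix.dotProduct_mulVec, Matrix.vecMul_mulVec, hBB', Matrix.vecMul_one, sqForm]
  have hinv : ∀ v, B.transpose.mulVec (B.mulVec v) = v := by
    intro v; rw [Matrix.mulVec_mulVec, hBB', Matrix.one_mulVec]
  refine ⟨B.transpose, by rwa [Matrix.transpose_transpose], ?_⟩
  have hgen := eq_id_or_conj_of_real (g := fun X => B.mulVec (f X - f 0))
    (by fun_prop) hn
    (by
      intro X Y hXY
      rw [← Matrix.mulVec_sub, hQ, sub_sub_sub_cancel_right]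
      exact h1 X Y hXY) hBx
  refine hgen.imp (fun h X => ?_) fun h X => ?_
  · have := hinv (f X - f 0)
    rw [h X] at this
    rw [this, sub_add_cancel]
  · rw [← h X, hinv, sub_add_cancel]

end

theorem theorem5 (n : ℕ) (hn : 2 ≤ n) (d : ℂ) (hd : d ≠ 0)
    (f : (Fin n → ℂ) → (Fin n → ℂ)) (hf : Continuous f) (hfd : PreservesDistance f d) :
    ∃ (ρ : ℂ → ℂ) (I : (Fin n → ℂ) →ᵃ[ℂ] (Fin n → ℂ)),
      (ρ = id ∨ ρ = tauD d) ∧ HasOrthogonalLinearPart I ∧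
        f = (I : (Fin n → ℂ) → (Fin n → ℂ)) ∘ (fun X i => ρ (X i)) := by
  -- Undoing this rescaling turns conjugation into `d * conj (d⁻¹ x)`, which is `tauD d x`.
  have h1 : PreservesForm (fun X => d⁻¹ • f (d • X)) 1 := by
    intro X Y hXY
    have := hfd (d • X) (d • Y) (by rw [phi_eq_sqForm, ← smul_sub, sqForm_smul, hXY, mul_one])
    rw [phi_eq_sqForm] at this
    rw [← smul_sub, sqForm_smul, this]; field_simp
  obtain ⟨A, hA, h⟩ := exists_orthogonal_of_preservesForm_one (by fun_prop) hn h1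
  have hfX : ∀ X, f X = d • (d⁻¹ • f (d • (d⁻¹ • X))) := by
    intro X; rw [smul_inv_smul₀ hd, smul_inv_smul₀ hd]
  let I : (Fin n → ℂ) →ᵃ[ℂ] (Fin n → ℂ) :=
    (Matrix.toLin' A).toAffineMap + AffineMap.const ℂ (Fin n → ℂ) (f 0)
  have hI : ∀ v, I v = A.mulVec v + f 0 := fun v => by simp [I]
  have hIo : HasOrthogonalLinearPart I := by
    rw [HasOrthogonalLinearPart, show I.linear = Matrix.toLin' A by simp [I],
      LinearMap.toMatrix'_toLin', Matrix.mem_orthogonalGroup_iff]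
    exact hA
  rcases h with h | h
  · refine ⟨id, I, Or.inl rfl, hIo, funext fun X => ?_⟩
    rw [hfX, h, Function.comp_apply, hI, smul_add, ← Matrix.mulVec_smul, smul_inv_smul₀ hd,
      smul_zero, smul_inv_smul₀ hd]
    rfl
  · refine ⟨tauD d, I, Or.inr rfl, hIo, funext fun X => ?_⟩
    rw [hfX, h, Function.comp_apply, hI, smul_add, ← Matrix.mulVec_smul,
      smul_zero, smul_inv_smul₀ hd]
    congr 2
    ext i
    simp [tauD]; ring
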